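/- Let $\beta>0$. Let $\mathbb{Q}^{(\beta)}=(\mathbb{Q}^{(\beta)}_t)_{t\ge 0}$ be the transition semi-group of the linear birth–death chain on $\mathbb{Z}_+$ that jumps from $n$ to $n+1$ at rate $n+\beta$ and from $n$ to $n-1$ at rate $n$, i.e. whose generator is $\mathbb{G}_\beta g(n)=(n+\beta)(g(n+1)-g(n))+n(g(n-1)-g(n))$. Let $\Lambda$ be the Markov kernel from $\mathbb{R}_+$ to $\mathbb{Z}_+$ given by $\Lambda g(x)=\mathbb{E}[g(\mathrm{Pois}(x))]$, with $\mathrm{Pois}(x)$ a Poisson variable of parameter $x$, and $\Lambda^*$ the Markov kernel from $\mathbb{Z}_+$ to $\mathbb{R}_+$ given by $\Lambda^* f(n)=\mathbb{E}[f(\mathrm{Gam}(n+\beta))]$, with $\mathrm{Gam}(n+\beta)$ a standard gamma variable of shape $n+\beta$. Then $$\Lambda^*\Lambda=\mathbb{Q}^{(\beta)}_1$$ as Markov kernels on $\mathbb{Z}_+$, and hence on bounded functions and in particular on $\mathbf{c}_0(\mathbb{Z}_+)$. The same identity holds on $\ell^2(\mathbf{m}_\beta)$, where $\mathbf{m}_\beta(n)=\frac{(n+\beta-1)(n+\beta-2)\cdots\beta}{n!}$,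 $\Lambda$ is regarded as the bounded operator $\ell^2(\mathbf{m}_\beta)\to\mathbf{L}^2(\mu_\beta)$ with $\mu_\beta(dx)=\frac{x^{\beta-1}}{\Gamma(\beta)}dx$ on $(0,\infty)$, $\Lambda^*$ is its Hilbert space adjoint, and $\mathbb{Q}^{(\beta)}_1g(n)=\sum_{m}\mathbb{Q}^{(\beta)}_1(n,m)g(m)$ (an absolutely convergent series) for $g\in\ell^2(\mathbf{m}_\beta)$. Moreover, for all $m,n\in\mathbb{Z}_+$, $$\mathbb{Q}^{(\beta)}_1(n,m)=2^{-(m+n+\beta)}\,\frac{(m+n+\beta-1)(m+n+\beta-2)\cdots(n+\beta)}{m!}.$$ -/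

import Mathlib

open MeasureTheory ProbabilityTheory
open scoped NNReal ENNReal Nat

noncomputable section

namespace BesselGateway

/-! ### The linear birth-death semi-group

The chain on `ℕ` with generator
`𝔾 g n = (n + β) (g (n + 1) - g n) + n (g (n - 1) - g n)`:
from `n` it jumps to `n + 1` at rate `n + β` and to `n - 1` at rate `n`, so that the holding time
at `n` is exponential of parameter `2 n + β`. -/

/-- `bdApprox β k t n m`: the probability that the birth-death chain started from `n` is at `m`
at time `t`, after having made at most `k` jumps. It is computed by conditioning on the time `s`
and on the target of the first jump; the density of a first jump at time `s` to `n + 1` is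
`exp (-(2 n + β) s) (n + β)`, and to `n - 1` it is `exp (-(2 n + β) s) n` (which vanishes for
`n = 0`). -/
def bdApprox (β : ℝ) : ℕ → ℝ → ℕ → ℕ → ℝ≥0∞
  | 0, t, n, m => if n = m then ENNReal.ofReal (Real.exp (-((2 * n + β) * t))) else 0
  | k + 1, t, n, m =>
      (if n = m then ENNReal.ofReal (Real.exp (-((2 * n + β) * t))) else 0) +
        ∫⁻ s in Set.Ioc 0 t, ENNReal.ofReal (Real.exp (-((2 * n + β) * s))) *
          (ENNReal.ofReal (n + β) * bdApprox β k (t - s) (n + 1) m +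
            ENNReal.ofReal n * bdApprox β k (t - s) (n - 1) m)

/-- The transition probability `ℚ_t(n, m)` of the birth-death chain: the supremum (increasing
limit) over the number of jumps allowed before time `t`. -/
def bdTransition (β t : ℝ) (n m : ℕ) : ℝ≥0∞ := ⨆ k, bdApprox β k t n m

/-- The birth-death semi-group `ℚ_t`, as a kernel on `ℕ`. -/
def bdKernel (β t : ℝ) : Kernel ℕ ℕ :=
  Kernel.ofFunOfCountable fun n => Measure.sum fun m => bdTransition β t n m • Measure.dirac m

/-- The birth-death semi-group acting on functions: `ℚ_t g (n) = ∑ₘ ℚ_t(n, m) g m`. -/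
def bdOp (β t : ℝ) (g : ℕ → ℝ) (n : ℕ) : ℝ := ∫ m, g m ∂(bdKernel β t n)

/-! ### The intertwining Markov kernels -/

lemma measurable_poissonMeasure : Measurable fun x : ℝ≥0 => poissonMeasure x := by
  refine Measure.measurable_of_measurable_coe _ fun s hs => ?_
  simp only [poissonMeasure, Measure.sum_apply _ hs, Measure.smul_apply, smul_eq_mul]
  fun_prop

/-- The Markov kernel `Λ` from `ℝ₊` to `ℕ`: `Λ(x, ·)` is the Poisson law of parameter `x`. -/
def poissonKernel : Kernel ℝ≥0 ℕ := ⟨poissonMeasure, measurable_poissonMeasure⟩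

/-- The Markov kernel `Λ*` from `ℕ` to `ℝ₊`: `Λ*(n, ·)` is the standard gamma law with shape
parameter `n + β`. -/
def gammaKernel (β : ℝ) : Kernel ℕ ℝ≥0 :=
  Kernel.ofFunOfCountable fun n => (gammaMeasure (n + β) 1).map Real.toNNReal

/-- `Λ g (x) = 𝔼[g (Pois x)]`. -/
def Lam (g : ℕ → ℝ) (x : ℝ≥0) : ℝ := ∫ n, g n ∂(poissonKernel x)

/-- `Λ* f (n) = 𝔼[f (Gam (n + β))]`. -/
def LamStar (β : ℝ) (f : ℝ≥0 → ℝ) (n : ℕ) : ℝ := ∫ x, f x ∂(gammaKernel β n)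

/-! ### The Hilbert spaces and `Λ` as an operator between them -/

/-- The weight `(n + β - 1) (n + β - 2) ⋯ β / n!`. -/
def mWeight (β : ℝ) (n : ℕ) : ℝ := (∏ i ∈ Finset.range n, (β + i)) / n !

/-- The measure on `ℕ` that gives mass `(n + β - 1) (n + β - 2) ⋯ β / n!` to `n`. -/
def mMeasure (β : ℝ) : Measure ℕ :=
  Measure.sum fun n => ENNReal.ofReal (mWeight β n) • Measure.dirac n

/-- The measure `x ^ (β - 1) / Γ(β) dx` on `ℝ₊`. -/
def muMeasure (β : ℝ) : Measure ℝ≥0 :=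
  ((volume.restrict (Set.Ioi (0 : ℝ))).withDensity fun x =>
    ENNReal.ofReal (x ^ (β - 1) / Real.Gamma β)).map Real.toNNReal

instance (x : ℝ≥0) : IsProbabilityMeasure (poissonKernel x) :=
  inferInstanceAs (IsProbabilityMeasure (poissonMeasure x))

lemma Gamma_add_nat {β : ℝ} (hβ : 0 < β) (n : ℕ) :
    Real.Gamma (n + β) = (∏ i ∈ Finset.range n, (β + i)) * Real.Gamma β := by
  induction n with
  | zero => simp
  | succ n ih =>
    have h : (n : ℝ) + β ≠ 0 := by positivity
    rw [Finset.prod_range_succ, show ((n + 1 : ℕ) : ℝ) + β = (n + β) + 1 by push_cast; ring,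
      Real.Gamma_add_one h, ih]
    ring

lemma lintegral_poissonKernel_singleton {β : ℝ} (hβ : 0 < β) (n : ℕ) :
    ∫⁻ x, poissonKernel x {n} ∂(muMeasure β) = ENNReal.ofReal (mWeight β n) := by
  have hm : Measurable fun x : ℝ≥0 => poissonKernel x {n} :=
    poissonKernel.measurable_coe (measurableSet_singleton n)
  have hm' : Measurable ((fun x : ℝ≥0 => poissonKernel x {n}) ∘ Real.toNNReal) :=
    hm.comp (by fun_prop)
  rw [muMeasure, lintegral_map hm (by fun_prop)]
  refine (lintegral_withDensity_eq_lintegral_mul _ (by fun_prop) hm').trans ?_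
  have hG : 0 < Real.Gamma β := Real.Gamma_pos_of_pos hβ
  have hnb : 0 < (n : ℝ) + β := by positivity
  have key : ∀ x ∈ Set.Ioi (0 : ℝ),
      ((fun x => ENNReal.ofReal (x ^ (β - 1) / Real.Gamma β)) *
        ((fun x : ℝ≥0 => poissonKernel x {n}) ∘ Real.toNNReal)) x =
      ENNReal.ofReal ((1 / (Real.Gamma β * n !)) *
        (Real.exp (-x) * x ^ ((n : ℝ) + β - 1))) := by
    intro x hx
    have hx : 0 < x := hx
    simp only [Pi.mul_apply, Function.comp]
    change _ * poissonMeasure _ _ = _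
    rw [poissonMeasure_singleton, ← ENNReal.ofReal_mul (by positivity),
      Real.coe_toNNReal x hx.le, show (n : ℝ) + β - 1 = n + (β - 1) by ring,
      Real.rpow_add hx, Real.rpow_natCast]
    congr 1
    field_simp
  have e : ∫⁻ x in Set.Ioi (0 : ℝ), ((fun x => ENNReal.ofReal (x ^ (β - 1) / Real.Gamma β)) *
        ((fun x : ℝ≥0 => poissonKernel x {n}) ∘ Real.toNNReal)) x =
      ∫⁻ x in Set.Ioi (0 : ℝ), ENNReal.ofReal ((1 / (Real.Gamma β * n !)) *
        (Real.exp (-x) * x ^ ((n : ℝ) + β - 1))) :=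
    setLIntegral_congr_fun measurableSet_Ioi key
  refine e.trans ?_
  rw [← ofReal_integral_eq_lintegral_ofReal]
  · rw [integral_const_mul, ← Real.Gamma_eq_integral hnb, Gamma_add_nat hβ, mWeight]
    congr 1
    field_simp
  · exact (Real.GammaIntegral_convergent hnb).const_mul _
  · filter_upwards [ae_restrict_mem measurableSet_Ioi] with x hx
    have hx : 0 < x := hx
    simp only [Pi.zero_apply]
    positivity

/-- `Λ` transports `muMeasure β` into `mMeasure β`. -/
lemma lintegral_lintegral_poissonKernel {β : ℝ} (hβ : 0 < β) (F : ℕ → ℝ≥0∞) :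
    ∫⁻ x, ∫⁻ n, F n ∂(poissonKernel x) ∂(muMeasure β) = ∫⁻ n, F n ∂(mMeasure β) := by
  have hm : ∀ n : ℕ, Measurable fun x : ℝ≥0 => poissonKernel x {n} := fun n =>
    poissonKernel.measurable_coe (measurableSet_singleton n)
  simp only [lintegral_countable']
  rw [lintegral_tsum fun n => ((hm n).const_mul _).aemeasurable]
  refine tsum_congr fun n => ?_
  rw [lintegral_const_mul _ (hm n), lintegral_poissonKernel_singleton hβ n, mMeasure,
    Measure.sum_smul_dirac_singleton]

lemma measurable_Lam (g : ℕ → ℝ) : Measurable (Lam g) := by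
  have h : StronglyMeasurable fun x => ∫ n, g n ∂(poissonKernel x) := by
    have : IsMarkovKernel poissonKernel := ⟨fun x => inferInstance⟩
    exact StronglyMeasurable.integral_kernel (measurable_of_countable g).stronglyMeasurable
  exact h.measurable

lemma mWeight_pos {β : ℝ} (hβ : 0 < β) (n : ℕ) : 0 < mWeight β n :=
  div_pos (Finset.prod_pos fun i _ => by positivity) (by positivity)

/-- Every point of `ℕ` has positive mass, so "almost everywhere" means "everywhere". -/
lemma eq_of_ae_mMeasure {β : ℝ} (hβ : 0 < β) {f g : ℕ → ℝ} (h : f =ᵐ[mMeasure β] g) :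
    f = g := by
  funext n
  by_contra hn
  have h0 : mMeasure β {n} = 0 := measure_mono_null (by simpa using hn) h
  rw [mMeasure, Measure.sum_smul_dirac_singleton, ENNReal.ofReal_eq_zero] at h0
  exact absurd (mWeight_pos hβ n) (not_lt.mpr h0)

lemma enorm_Lam_sq_le (g : ℕ → ℝ) (x : ℝ≥0) :
    ‖Lam g x‖ₑ ^ 2 ≤ ∫⁻ n, ‖g n‖ₑ ^ 2 ∂(poissonKernel x) := by
  have h1 : ‖Lam g x‖ₑ ≤ eLpNorm g 1 (poissonKernel x) := by
    rw [eLpNorm_one_eq_lintegral_enorm]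
    exact enorm_integral_le_lintegral_enorm _
  have h2 : eLpNorm g 1 (poissonKernel x) ≤ eLpNorm g 2 (poissonKernel x) :=
    eLpNorm_le_eLpNorm_of_exponent_le (by norm_num) (measurable_of_countable g).aestronglyMeasurable
  have h3 := eLpNorm_nnreal_pow_eq_lintegral (f := g) (μ := poissonKernel x) (p := 2) (by norm_num)
  norm_num at h3
  rw [← h3]
  gcongr
  exact h1.trans h2

lemma eLpNorm_Lam_le {β : ℝ} (hβ : 0 < β) (g : ℕ → ℝ) :
    eLpNorm (Lam g) 2 (muMeasure β) ≤ eLpNorm g 2 (mMeasure β) := by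
  have h3 := eLpNorm_nnreal_pow_eq_lintegral (f := Lam g) (μ := muMeasure β) (p := 2) (by norm_num)
  have h4 := eLpNorm_nnreal_pow_eq_lintegral (f := g) (μ := mMeasure β) (p := 2) (by norm_num)
  norm_num at h3 h4
  have h : eLpNorm (Lam g) 2 (muMeasure β) ^ 2 ≤ eLpNorm g 2 (mMeasure β) ^ 2 := by
    rw [h3, h4, ← lintegral_lintegral_poissonKernel hβ]
    exact lintegral_mono fun x => enorm_Lam_sq_le g x
  exact (ENNReal.pow_le_pow_left_iff two_ne_zero).1 h

lemma memLp_Lam {β : ℝ} (hβ : 0 < β) {g : ℕ → ℝ} (hg : MemLp g 2 (mMeasure β)) :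
    MemLp (Lam g) 2 (muMeasure β) :=
  ⟨(measurable_Lam g).aestronglyMeasurable, (eLpNorm_Lam_le hβ g).trans_lt hg.2⟩

lemma ae_integrable_poissonKernel {β : ℝ} (hβ : 0 < β) {g : ℕ → ℝ}
    (hg : MemLp g 2 (mMeasure β)) :
    ∀ᵐ x ∂(muMeasure β), Integrable g (poissonKernel x) := by
  have h4 := eLpNorm_nnreal_pow_eq_lintegral (f := g) (μ := mMeasure β) (p := 2) (by norm_num)
  norm_num at h4
  have hfin : ∫⁻ x, ∫⁻ n, ‖g n‖ₑ ^ 2 ∂(poissonKernel x) ∂(muMeasure β) ≠ ∞ := by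
    rw [lintegral_lintegral_poissonKernel hβ, ← h4]
    exact (ENNReal.pow_lt_top hg.2).ne
  have hmeas : Measurable fun x => ∫⁻ n, ‖g n‖ₑ ^ 2 ∂(poissonKernel x) :=
    Measurable.lintegral_kernel (measurable_of_countable _)
  filter_upwards [ae_lt_top hmeas hfin] with x hx
  have h5 := eLpNorm_nnreal_pow_eq_lintegral (f := g) (μ := poissonKernel x) (p := 2) (by norm_num)
  norm_num at h5
  have : MemLp g 2 (poissonKernel x) := by
    refine ⟨(measurable_of_countable g).aestronglyMeasurable, ?_⟩
    rw [← h5] at hx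
    exact (ENNReal.pow_lt_top_iff.1 hx).resolve_right two_ne_zero
  exact this.integrable (by norm_num)

/-- The bounded operator `Λ : ℓ²(m_β) → L²(μ_β)`, `Λ g (x) = 𝔼[g (Pois x)]`. -/
def LamL2 (β : ℝ) (hβ : 0 < β) : Lp ℝ 2 (mMeasure β) →L[ℝ] Lp ℝ 2 (muMeasure β) :=
  LinearMap.mkContinuous
    { toFun := fun g => (memLp_Lam hβ (Lp.memLp g)).toLp (Lam g)
      map_add' := fun f g => by
        rw [← MemLp.toLp_add]
        refine MemLp.toLp_congr _ _ ?_
        filter_upwards [ae_integrable_poissonKernel hβ (Lp.memLp f),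
          ae_integrable_poissonKernel hβ (Lp.memLp g)] with x hf hg
        rw [eq_of_ae_mMeasure hβ (Lp.coeFn_add f g)]
        exact integral_add hf hg
      map_smul' := fun c f => by
        rw [RingHom.id_apply, ← MemLp.toLp_const_smul]
        refine MemLp.toLp_congr _ _ (Filter.Eventually.of_forall fun x => ?_)
        rw [eq_of_ae_mMeasure hβ (Lp.coeFn_smul c f)]
        exact integral_smul c _ }
    1 fun g => by
      rw [one_mul]
      change ‖(memLp_Lam hβ (Lp.memLp g)).toLp (Lam g)‖ ≤ ‖g‖
      rw [Lp.norm_toLp, Lp.norm_def]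
      exact ENNReal.toReal_mono (Lp.memLp g).2.ne (eLpNorm_Lam_le hβ g)

end BesselGateway

end

noncomputable section

namespace BesselGateway

/-! ### Negative binomial weights -/

/-! The jump rates are affine in the state, so the law at time `t` from `n` has an explicit
generating function `a ^ n * b ^ (-(n + β))`, with `a = t + (1 - t) X` and `b = 1 + t - t X`. At `t
= 1` the factor `a` is `1` and only a negative binomial law of shape `n + β` is left. That is also
the Poisson law mixed over a gamma parameter (`lintegral_poissonMeasure_gammaMeasure`), whence the
kernel identity and the formula.

The main work is to show that the chain, built as a limit over the number of jumps, has this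
generating function (`bdTransition_eq_bdProb`). The coefficients solve the backward equation
(`hasCoeffDerivAt_bdSeries`) and lie in `[0, 1]` for `t ≤ 1`, so they are a fixed point of the
monotone first jump map (`ofReal_eq_add_firstJump`), whose iterates `bdApprox` stay below them.
Equality is non-explosion, obtained from an affine Lyapunov function (`bdProb_le_bdApprox_add`).

On `ℓ²`, a Bayes identity (`withDensity_poissonKernel_muMeasure`) identifies the adjoint of `Λ` with
the gamma kernel, and reversibility supplies integrability. -/

/-- The negative binomial weight `(1 + t)^(-γ - m) t^m γ (γ + 1) ⋯ (γ + m - 1) / m!`. -/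
def negBinCoeff (γ t : ℝ) (m : ℕ) : ℝ :=
  (1 + t) ^ (-γ - m) * t ^ m * ((∏ i ∈ Finset.range m, (γ + i)) / m !)

/-- The product of the two densities is a multiple of `x ^ (m + γ - 1) * exp (-(1 + t) x)`, a gamma
integral. General `t` is kept because it also yields `negBinCoeff_le_one` without summing the
negative binomial series. -/
lemma lintegral_poissonMeasure_gammaMeasure {γ t : ℝ} (hγ : 0 < γ) (ht : 0 ≤ t) (m : ℕ) :
    ∫⁻ x, poissonMeasure (t * x).toNNReal {m} ∂(gammaMeasure γ 1) =
      ENNReal.ofReal (negBinCoeff γ t m) := by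
  have hG : 0 < Real.Gamma γ := Real.Gamma_pos_of_pos hγ
  have hmγ : 0 < (m : ℝ) + γ := by positivity
  have h1t : 0 < 1 + t := by positivity
  have hmeas : Measurable fun x : ℝ => poissonMeasure (t * x).toNNReal {m} := by
    simp only [poissonMeasure_singleton]
    fun_prop
  have hpdf : Measurable (gammaPDF γ 1) := (measurable_gammaPDFReal γ 1).ennreal_ofReal
  rw [gammaMeasure, lintegral_withDensity_eq_lintegral_mul _ hpdf hmeas]
  have hzero : ∀ x ∉ Set.Ici (0 : ℝ), (gammaPDF γ 1 *
      fun x : ℝ => poissonMeasure (t * x).toNNReal {m}) x = 0 := by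
    intro x hx
    simp [gammaPDF_of_neg (not_le.1 hx)]
  rw [← setLIntegral_eq_of_support_subset (s := Set.Ici (0 : ℝ))
    fun x hx => by_contra fun h => hx (hzero x h), setLIntegral_congr Ioi_ae_eq_Ici.symm]
  have key : ∀ x ∈ Set.Ioi (0 : ℝ), (gammaPDF γ 1 *
      fun x : ℝ => poissonMeasure (t * x).toNNReal {m}) x =
      ENNReal.ofReal ((t ^ m / (Real.Gamma γ * m !)) *
        (x ^ ((m : ℝ) + γ - 1) * Real.exp (-((1 + t) * x)))) := by
    intro x hx
    have hx : 0 < x := hx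
    rw [Pi.mul_apply, gammaPDF_of_nonneg hx.le, poissonMeasure_singleton,
      ← ENNReal.ofReal_mul (by positivity), Real.coe_toNNReal _ (by positivity),
      show (m : ℝ) + γ - 1 = m + (γ - 1) by ring, Real.rpow_add hx, Real.rpow_natCast,
      show -((1 + t) * x) = -(1 * x) + -(t * x) by ring, Real.exp_add, mul_pow, Real.one_rpow]
    congr 1
    field_simp
  rw [setLIntegral_congr_fun measurableSet_Ioi key, ← ofReal_integral_eq_lintegral_ofReal]
  · rw [integral_const_mul, Real.integral_rpow_mul_exp_neg_mul_Ioi hmγ h1t, Gamma_add_nat hγ,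
      negBinCoeff, one_div, Real.inv_rpow h1t.le, ← Real.rpow_neg h1t.le, neg_add']
    congr 1
    rw [show -(m : ℝ) - γ = -γ - m by ring]
    field_simp
  · refine Integrable.const_mul ?_ _
    have := integrableOn_rpow_mul_exp_neg_mul_rpow (p := 1) (s := (m : ℝ) + γ - 1) (b := 1 + t)
      (by linarith) one_pos h1t
    simpa only [IntegrableOn, Real.rpow_one, neg_mul] using this
  · filter_upwards [ae_restrict_mem measurableSet_Ioi] with x hx
    have hx : 0 < x := hx
    simp only [Pi.zero_apply]
    positivity

lemma negBinCoeff_nonneg {γ t : ℝ} (hγ : 0 < γ) (ht : 0 ≤ t) (m : ℕ) :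
    0 ≤ negBinCoeff γ t m := by
  have : 0 ≤ ∏ i ∈ Finset.range m, (γ + i) := Finset.prod_nonneg fun i _ => by positivity
  unfold negBinCoeff
  positivity

lemma negBinCoeff_le_one {γ t : ℝ} (hγ : 0 < γ) (ht : 0 ≤ t) (m : ℕ) :
    negBinCoeff γ t m ≤ 1 := by
  have := isProbabilityMeasure_gammaMeasure hγ one_pos
  rw [← ENNReal.ofReal_le_one, ← lintegral_poissonMeasure_gammaMeasure hγ ht]
  calc ∫⁻ x, poissonMeasure (t * x).toNNReal {m} ∂(gammaMeasure γ 1)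
      ≤ ∫⁻ _, 1 ∂(gammaMeasure γ 1) := lintegral_mono fun x => prob_le_one
    _ = 1 := by simp

lemma negBinCoeff_succ_shape {γ t : ℝ} (ht : 0 < 1 + t) (m : ℕ) :
    negBinCoeff (γ + 1) t m * γ = negBinCoeff γ t m * ((γ + m) / (1 + t)) := by
  have h : γ * ∏ i ∈ Finset.range m, (γ + 1 + i) = (∏ i ∈ Finset.range m, (γ + i)) * (γ + m) := by
    rw [← Finset.prod_range_succ, Finset.prod_range_succ']
    rw [Nat.cast_zero, add_zero, mul_comm]
    congr 1
    exact Finset.prod_congr rfl fun i _ => by push_cast; ring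
  have h2 : (1 + t) ^ (-(γ + 1) - m) = (1 + t) ^ (-γ - m) / (1 + t) := by
    rw [← Real.rpow_sub_one ht.ne']; congr 1; ring
  rw [negBinCoeff, negBinCoeff, h2]
  linear_combination ((1 + t) ^ (-γ - m) / (1 + t) * t ^ m / m !) * h

lemma negBinCoeff_succ_index {γ t : ℝ} (ht : 0 < 1 + t) (m : ℕ) :
    negBinCoeff γ t (m + 1) * (m + 1) = negBinCoeff γ t m * (t * (γ + m) / (1 + t)) := by
  have h2 : (1 + t) ^ (-γ - (m + 1 : ℕ)) = (1 + t) ^ (-γ - m) / (1 + t) := by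
    rw [← Real.rpow_sub_one ht.ne']; congr 1; push_cast; ring
  rw [negBinCoeff, negBinCoeff, h2, Finset.prod_range_succ, Nat.factorial_succ]
  push_cast
  have : (m ! : ℝ) ≠ 0 := by positivity
  have : (m : ℝ) + 1 ≠ 0 := by positivity
  field_simp
  ring

lemma hasDerivAt_negBinCoeff {γ t : ℝ} (ht : 0 < 1 + t) (m : ℕ) :
    HasDerivAt (fun s => negBinCoeff γ s m)
      (negBinCoeff γ t m * ((-γ - m) / (1 + t)) + (1 + t) ^ (-γ - m) * (m * t ^ (m - 1)) *
        ((∏ i ∈ Finset.range m, (γ + i)) / m !)) t := by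
  have h1 : HasDerivAt (fun s : ℝ => (1 + s) ^ (-γ - m : ℝ))
      (1 * (-γ - m) * (1 + t) ^ (-γ - m - 1 : ℝ)) t :=
    ((hasDerivAt_id t).const_add 1).rpow_const (Or.inl ht.ne')
  have h := (h1.mul (hasDerivAt_pow m t)).mul_const ((∏ i ∈ Finset.range m, (γ + i)) / m !)
  refine h.congr_deriv ?_
  rw [Real.rpow_sub_one ht.ne', negBinCoeff]
  ring

/-! ### Generating functions -/

section GeneratingFunction

open PowerSeries

/-- The power series `(1 + t - t X)^(-γ)`. -/
def negBinSeries (γ t : ℝ) : ℝ⟦X⟧ := PowerSeries.mk (negBinCoeff γ t)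

/-- This is `b ^ (-γ) = b * b ^ (-γ - 1)` for `b = 1 + t - t X`, checked on coefficients through the
recurrences in shape and index. -/
lemma negBinSeries_eq_mul {γ t : ℝ} (hγ : 0 < γ) (ht : 0 < 1 + t) :
    negBinSeries γ t = (C (1 + t) - C t * X) * negBinSeries (γ + 1) t := by
  ext m
  rw [sub_mul, mul_assoc, map_sub, coeff_C_mul, coeff_C_mul]
  cases m with
  | zero =>
    have h := negBinCoeff_succ_shape (γ := γ) ht 0
    simp only [negBinSeries, coeff_mk, coeff_zero_X_mul, mul_zero, sub_zero]
    field_simp at h ⊢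
    push_cast at h
    apply mul_right_cancel₀ hγ.ne'
    linear_combination -h
  | succ m =>
    have h := negBinCoeff_succ_shape (γ := γ) ht m
    have h' := negBinCoeff_succ_shape (γ := γ) ht (m + 1)
    have h'' := negBinCoeff_succ_index (γ := γ) ht m
    simp only [negBinSeries, coeff_mk, coeff_succ_X_mul]
    push_cast at h'
    field_simp at h h' h''
    apply mul_right_cancel₀ hγ.ne'
    apply mul_right_cancel₀ ht.ne'
    linear_combination -(1 + t) * h' + t * h - h''

/-- Coefficientwise differentiability of a family of power series. -/
def HasCoeffDerivAt (F : ℝ → ℝ⟦X⟧) (F' : ℝ⟦X⟧) (t : ℝ) : Prop :=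
  ∀ m, HasDerivAt (fun s => coeff m (F s)) (coeff m F') t

lemma HasCoeffDerivAt.mul {F G : ℝ → ℝ⟦X⟧} {F' G' : ℝ⟦X⟧} {t : ℝ}
    (hF : HasCoeffDerivAt F F' t) (hG : HasCoeffDerivAt G G' t) :
    HasCoeffDerivAt (fun s => F s * G s) (F' * G t + F t * G') t := by
  intro m
  simp only [coeff_mul, map_add, ← Finset.sum_add_distrib]
  exact HasDerivAt.fun_sum fun p _ => (hF p.1).mul (hG p.2)

lemma HasCoeffDerivAt.pow {F : ℝ → ℝ⟦X⟧} {F' : ℝ⟦X⟧} {t : ℝ}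
    (hF : HasCoeffDerivAt F F' t) (n : ℕ) :
    HasCoeffDerivAt (fun s => F s ^ n) (n * F t ^ (n - 1) * F') t := by
  induction n with
  | zero => intro m; simpa using hasDerivAt_const t _
  | succ n ih =>
    have h := ih.mul hF
    simp only [pow_succ]
    convert h using 1
    cases n with
    | zero => simp
    | succ n => push_cast; ring

lemma hasCoeffDerivAt_negBinSeries {γ t : ℝ} (hγ : 0 < γ) (ht : 0 < 1 + t) :
    HasCoeffDerivAt (negBinSeries γ) (-C γ * (1 - X) * negBinSeries (γ + 1) t) t := by
  intro m
  have hd := hasDerivAt_negBinCoeff (γ := γ) ht m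
  simp only [negBinSeries, coeff_mk]
  refine hd.congr_deriv ?_
  rw [← negBinSeries]
  rw [show -C γ * (1 - X) * negBinSeries (γ + 1) t =
    C γ * (X * negBinSeries (γ + 1) t) - C γ * negBinSeries (γ + 1) t by ring, map_sub,
    coeff_C_mul, coeff_C_mul]
  have h' := negBinCoeff_succ_shape (γ := γ) ht m
  cases m with
  | zero =>
    simp only [negBinSeries, coeff_mk, coeff_zero_X_mul]
    push_cast at h' ⊢
    linear_combination h'
  | succ m =>
    have h := negBinCoeff_succ_shape (γ := γ) ht m
    have hs : (1 + t) ^ (-γ - (m + 1 : ℕ)) * ((m + 1 : ℕ) * t ^ m) *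
        ((∏ i ∈ Finset.range (m + 1), (γ + i)) / (m + 1)!) =
        negBinCoeff γ t m * ((γ + m) / (1 + t)) := by
      have h2 : (1 + t) ^ (-γ - (m + 1 : ℕ)) = (1 + t) ^ (-γ - m) / (1 + t) := by
        rw [← Real.rpow_sub_one ht.ne']; congr 1; push_cast; ring
      rw [negBinCoeff, h2, Finset.prod_range_succ, Nat.factorial_succ]
      push_cast
      have : (m ! : ℝ) ≠ 0 := by positivity
      have : (m : ℝ) + 1 ≠ 0 := by positivity
      field_simp
    simp only [negBinSeries, coeff_mk, coeff_succ_X_mul, Nat.add_sub_cancel]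
    rw [hs, ← h]
    linear_combination h'

lemma hasCoeffDerivAt_linear (t : ℝ) :
    HasCoeffDerivAt (fun s => C s + C (1 - s) * X) (1 - X) t := by
  intro m
  have h0 := (hasDerivAt_id t).mul_const (coeff m (1 : ℝ⟦X⟧))
  have h1 := ((hasDerivAt_id t).const_sub 1).mul_const (coeff m (X : ℝ⟦X⟧))
  have h := h0.add h1
  have e : (fun s : ℝ => coeff m (C s + C (1 - s) * X)) =
      (fun s => id s * coeff m (1 : ℝ⟦X⟧)) + fun s => (1 - id s) * coeff m (X : ℝ⟦X⟧) := by
    funext s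
    rw [map_add, coeff_C_mul, ← mul_one (C s), coeff_C_mul]
    rfl
  rw [e]
  refine h.congr_deriv ?_
  rw [map_sub]
  ring

/-- The generating function `(t + (1 - t) X)^n (1 + t - t X)^(-(n + β))` of the law at time `t` of
the birth-death chain started from `n`. -/
def bdSeries (β t : ℝ) (n : ℕ) : ℝ⟦X⟧ := (C t + C (1 - t) * X) ^ n * negBinSeries (n + β) t

/-- Both `a = t + (1 - t) X` and `b = 1 + t - t X` have time derivative `1 - X`, and `b - a = 1 - X`
as well. Hence the two terms of the product rule are exactly the two differences in the generator.
-/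
lemma hasCoeffDerivAt_bdSeries {β t : ℝ} (hβ : 0 < β) (ht : 0 < 1 + t) (n : ℕ) :
    HasCoeffDerivAt (fun s => bdSeries β s n)
      (C (n + β) * (bdSeries β t (n + 1) - bdSeries β t n) +
        C (n : ℝ) * (bdSeries β t (n - 1) - bdSeries β t n)) t := by
  have hn : 0 < (n : ℝ) + β := by positivity
  have h := ((hasCoeffDerivAt_linear t).pow n).mul (hasCoeffDerivAt_negBinSeries hn ht)
  unfold bdSeries
  convert h using 1
  have e : ((n + 1 : ℕ) : ℝ) + β = n + β + 1 := by push_cast; ring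
  have hb := negBinSeries_eq_mul hn ht
  cases n with
  | zero =>
    rw [e]
    simp only [Nat.cast_zero, zero_add, pow_one, pow_zero, map_zero, zero_mul, add_zero,
      Nat.zero_sub, one_mul] at hb ⊢
    rw [hb]
    simp only [map_add, map_sub, map_one]
    ring
  | succ n =>
    have hn' : 0 < (n : ℝ) + β := by positivity
    have hb' := negBinSeries_eq_mul hn' ht
    have e' : ((n + 1 : ℕ) : ℝ) + β = n + β + 1 := by push_cast; ring
    rw [e]
    simp only [Nat.add_sub_cancel]
    rw [hb', ← e', hb]
    simp only [map_add, map_sub, map_one, Nat.cast_add, Nat.cast_one, pow_succ, map_natCast]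
    ring

/-- Multiplying by `t + (1 - t) X` replaces each coefficient by a convex combination of itself and
its predecessor. This is what confines the argument to `t ≤ 1`. -/
lemma coeff_bdSeries_mem_Icc {β t : ℝ} (hβ : 0 < β) (ht : t ∈ Set.Icc (0 : ℝ) 1) (n m : ℕ) :
    coeff m (bdSeries β t n) ∈ Set.Icc (0 : ℝ) 1 := by
  have hn : 0 < (n : ℝ) + β := by positivity
  have key : ∀ k m : ℕ, coeff m ((C t + C (1 - t) * X) ^ k * negBinSeries (n + β) t) ∈
      Set.Icc (0 : ℝ) 1 := by
    intro k
    induction k with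
    | zero =>
      intro m
      simpa [negBinSeries] using
        ⟨negBinCoeff_nonneg hn ht.1 m, negBinCoeff_le_one hn ht.1 m⟩
    | succ k ih =>
      intro m
      set ψ := (C t + C (1 - t) * X) ^ k * negBinSeries (n + β) t
      rw [show (C t + C (1 - t) * X) ^ (k + 1) * negBinSeries (n + β) t =
        C t * ψ + C (1 - t) * (X * ψ) by simp only [ψ]; ring, map_add, coeff_C_mul, coeff_C_mul]
      have hx : coeff m (X * ψ) ∈ Set.Icc (0 : ℝ) 1 := by
        cases m with
        | zero => simp
        | succ m => rw [coeff_succ_X_mul]; exact ih m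
      exact convex_Icc (0 : ℝ) 1 (ih m) hx ht.1 (sub_nonneg.2 ht.2) (by ring)
  exact key n m

lemma coeff_bdSeries_zero (β : ℝ) (n m : ℕ) :
    coeff m (bdSeries β 0 n) = if n = m then 1 else 0 := by
  have h : negBinSeries (n + β) 0 = 1 := by
    ext k
    cases k <;> simp [negBinSeries, negBinCoeff, coeff_one]
  simp [bdSeries, h, coeff_X_pow, eq_comm]

lemma coeff_bdSeries_one (β : ℝ) (n m : ℕ) :
    coeff m (bdSeries β 1 n) = negBinCoeff (n + β) 1 m := by
  simp [bdSeries, negBinSeries]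

end GeneratingFunction

/-! ### The first jump decomposition -/

/-- The expectation of `f (t - τ) (X τ)` on the event `τ ≤ t`, where `τ` is the first jump time of
the birth-death chain `X` started from `n`. -/
def firstJump (β : ℝ) (f : ℝ → ℕ → ℝ≥0∞) (t : ℝ) (n : ℕ) : ℝ≥0∞ :=
  ∫⁻ s in Set.Ioc 0 t, ENNReal.ofReal (Real.exp (-((2 * n + β) * s))) *
    (ENNReal.ofReal (n + β) * f (t - s) (n + 1) + ENNReal.ofReal n * f (t - s) (n - 1))

lemma bdApprox_succ (β : ℝ) (k : ℕ) (t : ℝ) (n m : ℕ) :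
    bdApprox β (k + 1) t n m =
      bdApprox β 0 t n m + firstJump β (fun s j => bdApprox β k s j m) t n := by
  simp only [bdApprox, firstJump]

lemma firstJump_mono {β t : ℝ} {f g : ℝ → ℕ → ℝ≥0∞}
    (h : ∀ s ∈ Set.Icc 0 t, ∀ n, f s n ≤ g s n) (n : ℕ) :
    firstJump β f t n ≤ firstJump β g t n := by
  refine setLIntegral_mono' measurableSet_Ioc fun s hs => ?_
  have hs' : t - s ∈ Set.Icc 0 t := ⟨by linarith [hs.2], by linarith [hs.1]⟩
  gcongr <;> exact h _ hs' _

/-- Measurability is required of one summand only, so that the other can be `bdApprox`, whose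
measurability in time is never established. -/
lemma firstJump_add {β t : ℝ} {f g : ℝ → ℕ → ℝ≥0∞} (hg : ∀ n, Measurable fun s => g s n) (n : ℕ) :
    firstJump β (fun s j => f s j + g s j) t n = firstJump β f t n + firstJump β g t n := by
  have hgs : ∀ j, Measurable fun s => g (t - s) j := fun j =>
    (hg j).comp (measurable_const.sub measurable_id)
  rw [firstJump, firstJump, firstJump, ← lintegral_add_right]
  · congr 1 with s
    ring
  · have := hgs (n + 1)
    have := hgs (n - 1)
    fun_prop

/-- `u` solves the backward equation `∂ₜ u = 𝔾 u` of the birth-death chain at time `t`. -/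
def BackwardEqAt (β : ℝ) (u : ℝ → ℕ → ℝ) (t : ℝ) : Prop :=
  ∀ n : ℕ, HasDerivAt (fun s => u s n)
    ((n + β) * (u t (n + 1) - u t n) + n * (u t (n - 1) - u t n)) t

/-- Nonnegative solutions of the backward equation solve the first jump integral equation. -/
lemma ofReal_eq_add_firstJump {β t : ℝ} (hβ : 0 < β) (ht : 0 ≤ t) {u : ℝ → ℕ → ℝ}
    (h0 : ∀ s ∈ Set.Icc 0 t, ∀ n, 0 ≤ u s n) (hu : ∀ s ∈ Set.Icc 0 t, BackwardEqAt β u s) (n : ℕ) :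
    ENNReal.ofReal (u t n) = ENNReal.ofReal (Real.exp (-((2 * n + β) * t)) * u 0 n) +
      firstJump β (fun s j => ENNReal.ofReal (u s j)) t n := by
  set F : ℝ → ℝ := fun s => Real.exp (-((2 * n + β) * s)) *
    ((n + β) * u (t - s) (n + 1) + n * u (t - s) (n - 1))
  have hmem : ∀ s ∈ Set.Icc 0 t, t - s ∈ Set.Icc 0 t := fun s hs =>
    ⟨by linarith [hs.2], by linarith [hs.1]⟩
  have hsub : ∀ s ∈ Set.Icc 0 t, ∀ j, HasDerivAt (fun s => u (t - s) j)
      (-((j + β) * (u (t - s) (j + 1) - u (t - s) j) +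
        j * (u (t - s) (j - 1) - u (t - s) j))) s := fun s hs j => by
    simpa using HasDerivAt.comp_const_sub t s (hu (t - s) (hmem s hs) j)
  have hexp : ∀ s, HasDerivAt (fun s => Real.exp (-((2 * n + β) * s)))
      (Real.exp (-((2 * n + β) * s)) * -((2 * n + β) * 1)) s := fun s =>
    (((hasDerivAt_id s).const_mul (2 * n + β)).neg).exp
  -- Variation of constants: differentiating the exponential cancels the diagonal term `(2 n + β) u`
  -- of the generator, leaving only the jump terms `F`.
  have hderiv : ∀ s ∈ Set.uIcc 0 t,
      HasDerivAt (fun s => -(Real.exp (-((2 * n + β) * s)) * u (t - s) n)) (F s) s := by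
    intro s hs
    rw [Set.uIcc_of_le ht] at hs
    refine ((hexp s).mul (hsub s hs n)).neg.congr_deriv ?_
    simp only [F]
    ring
  have hcont : ContinuousOn F (Set.Icc 0 t) := by
    have hc : ∀ j, ContinuousOn (fun s => u (t - s) j) (Set.Icc 0 t) := fun j s hs =>
      (hsub s hs j).continuousAt.continuousWithinAt
    exact (Continuous.continuousOn (by fun_prop)).mul
      ((continuousOn_const.mul (hc (n + 1))).add (continuousOn_const.mul (hc (n - 1))))
  have hint : IntervalIntegrable F volume 0 t :=
    ContinuousOn.intervalIntegrable (by rwa [Set.uIcc_of_le ht])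
  have hF0 : ∀ s ∈ Set.Icc 0 t, 0 ≤ F s := fun s hs => by
    have := h0 _ (hmem s hs) (n + 1)
    have := h0 _ (hmem s hs) (n - 1)
    positivity
  have hftc := intervalIntegral.integral_eq_sub_of_hasDerivAt hderiv hint
  have hjump : firstJump β (fun s j => ENNReal.ofReal (u s j)) t n =
      ENNReal.ofReal (∫ s in 0..t, F s) := by
    rw [intervalIntegral.integral_of_le ht, ofReal_integral_eq_lintegral_ofReal hint.1]
    · refine setLIntegral_congr_fun measurableSet_Ioc fun s hs => ?_
      have hs' := hmem s ⟨hs.1.le, hs.2⟩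
      have := h0 _ hs' (n + 1)
      have := h0 _ hs' (n - 1)
      simp only [F]
      rw [ENNReal.ofReal_mul (by positivity), ENNReal.ofReal_add
        (p := (n + β) * u (t - s) (n + 1)) (by positivity) (by positivity),
        ENNReal.ofReal_mul (p := (n : ℝ) + β) (by positivity), ENNReal.ofReal_mul (by positivity)]
    · filter_upwards [ae_restrict_mem measurableSet_Ioc] with s hs
      exact hF0 s ⟨hs.1.le, hs.2⟩
  have h0' := h0 0 ⟨le_rfl, ht⟩ n
  rw [hjump, ← ENNReal.ofReal_add (by positivity)
    (intervalIntegral.integral_nonneg ht hF0), hftc]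
  simp

/-! ### The transition probabilities up to time one -/

/-- The explicit transition probability of the birth-death chain, for times in `[0, 1]`. -/
def bdProb (β t : ℝ) (n m : ℕ) : ℝ := PowerSeries.coeff m (bdSeries β t n)

lemma ofReal_bdProb {β t : ℝ} (hβ : 0 < β) (ht : t ∈ Set.Icc (0 : ℝ) 1) (n m : ℕ) :
    ENNReal.ofReal (bdProb β t n m) =
      bdApprox β 0 t n m + firstJump β (fun s j => ENNReal.ofReal (bdProb β s j m)) t n := by
  rw [ofReal_eq_add_firstJump hβ ht.1 (u := fun s j => bdProb β s j m)
    (fun s hs j => (coeff_bdSeries_mem_Icc hβ ⟨hs.1, hs.2.trans ht.2⟩ j m).1)]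
  · congr 1
    rw [bdProb, coeff_bdSeries_zero]
    split_ifs with h <;> simp [bdApprox, h]
  · intro s hs j
    refine (hasCoeffDerivAt_bdSeries hβ (by linarith [hs.1]) j m).congr_deriv ?_
    rw [map_add (PowerSeries.coeff m), PowerSeries.coeff_C_mul, PowerSeries.coeff_C_mul,
      map_sub, map_sub]
    rfl

lemma bdApprox_le_bdProb {β : ℝ} (hβ : 0 < β) (m k : ℕ) :
    ∀ t ∈ Set.Icc (0 : ℝ) 1, ∀ n, bdApprox β k t n m ≤ ENNReal.ofReal (bdProb β t n m) := by
  induction k with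
  | zero =>
    intro t ht n
    rw [ofReal_bdProb hβ ht]
    exact le_self_add
  | succ k ih =>
    intro t ht n
    rw [ofReal_bdProb hβ ht, bdApprox_succ]
    gcongr
    exact firstJump_mono (fun s hs => ih s ⟨hs.1, hs.2.trans ht.2⟩) n

/-- The first jump operator contracts the constants on `{n ≤ N}`; the affine function
`(n + β t) / N`, which is a solution of the backward equation, dominates `1` on `{N ≤ n}`. -/
lemma firstJump_affine_le {β t : ℝ} (hβ : 0 < β) (ht : t ∈ Set.Icc (0 : ℝ) 1) {N n : ℕ}
    (hn : n ≤ N) {c : ℝ} (hc : 0 ≤ c) :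
    firstJump β (fun s j => ENNReal.ofReal ((j + β * s) / N + c)) t n ≤
      ENNReal.ofReal ((n + β * t) / N + (1 - Real.exp (-(2 * N + β))) * c) := by
  have h := ofReal_eq_add_firstJump hβ ht.1 (u := fun s j => (j + β * s) / N + c)
    (fun s hs j => by have := hs.1; positivity) (fun s hs j => by
      have hd := ((((hasDerivAt_id s).const_mul β).const_add (j : ℝ)).div_const (N : ℝ)).add_const c
      refine hd.congr_deriv ?_
      cases j with
      | zero => push_cast; ring
      | succ j => push_cast; ring) n
  have hJ : firstJump β (fun s j => ENNReal.ofReal ((j + β * s) / N + c)) t n =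
      ENNReal.ofReal ((n + β * t) / N + c) -
        ENNReal.ofReal (Real.exp (-((2 * n + β) * t)) * ((n + β * 0) / N + c)) := by
    rw [h, ENNReal.add_sub_cancel_left ENNReal.ofReal_ne_top]
  rw [hJ, ← ENNReal.ofReal_sub _ (by positivity)]
  refine ENNReal.ofReal_le_ofReal ?_
  have hnN : (n : ℝ) ≤ N := by exact_mod_cast hn
  -- The probability of no jump is bounded below uniformly over `n ≤ N` and `t ≤ 1`; this gives the
  -- contraction of `c`.
  have he : Real.exp (-(2 * N + β)) ≤ Real.exp (-((2 * n + β) * t)) := by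
    refine Real.exp_le_exp.2 (neg_le_neg ?_)
    calc (2 * n + β) * t ≤ (2 * n + β) * 1 := by gcongr; exact ht.2
      _ ≤ 2 * N + β := by linarith
  have h1 : 0 ≤ Real.exp (-((2 * n + β) * t)) * ((n + β * 0) / N) := by positivity
  have h2 := mul_le_mul_of_nonneg_right he hc
  linarith

/-- The error is dominated by an affine function plus a constant. For `n ≤ N` another jump shrinks
the constant by a fixed factor; for `n ≥ N` the affine part is at least `1`, and the trivial bound
`bdProb ≤ 1` suffices. -/
lemma bdProb_le_bdApprox_add {β : ℝ} (hβ : 0 < β) (m : ℕ) {N : ℕ} (hN : 0 < N) (k : ℕ) :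
    ∀ t ∈ Set.Icc (0 : ℝ) 1, ∀ n, ENNReal.ofReal (bdProb β t n m) ≤
      bdApprox β k t n m +
        ENNReal.ofReal ((n + β * t) / N + (1 - Real.exp (-(2 * N + β))) ^ k) := by
  have hρ : 0 ≤ 1 - Real.exp (-(2 * N + β)) := by
    rw [sub_nonneg, Real.exp_le_one_iff]
    have : (0 : ℝ) ≤ 2 * N + β := by positivity
    linarith
  have hone : ∀ t ∈ Set.Icc (0 : ℝ) 1, ∀ n : ℕ, ∀ c : ℝ, 1 ≤ (n + β * t) / N + c →
      ∀ k, ENNReal.ofReal (bdProb β t n m) ≤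
        bdApprox β k t n m + ENNReal.ofReal ((n + β * t) / N + c) := fun t ht n c hc k =>
    le_add_left (ENNReal.ofReal_le_ofReal ((coeff_bdSeries_mem_Icc hβ ht n m).2.trans hc))
  induction k with
  | zero =>
    intro t ht n
    refine hone t ht n _ ?_ 0
    have := ht.1
    rw [pow_zero, le_add_iff_nonneg_left]
    positivity
  | succ k ih =>
    intro t ht n
    rcases le_total n N with hn | hn
    · calc ENNReal.ofReal (bdProb β t n m)
          = bdApprox β 0 t n m +
            firstJump β (fun s j => ENNReal.ofReal (bdProb β s j m)) t n := ofReal_bdProb hβ ht n m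
        _ ≤ bdApprox β 0 t n m + firstJump β (fun s j => bdApprox β k s j m +
              ENNReal.ofReal ((j + β * s) / N + (1 - Real.exp (-(2 * N + β))) ^ k)) t n := by
            gcongr
            exact firstJump_mono (fun s hs => ih s ⟨hs.1, hs.2.trans ht.2⟩) n
        _ = bdApprox β (k + 1) t n m + firstJump β (fun s j =>
              ENNReal.ofReal ((j + β * s) / N + (1 - Real.exp (-(2 * N + β))) ^ k)) t n := by
            rw [firstJump_add fun j => by fun_prop, bdApprox_succ, add_assoc]
        _ ≤ _ := by
            gcongr
            rw [pow_succ']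
            exact firstJump_affine_le hβ ht hn (pow_nonneg hρ k)
    · refine hone t ht n _ ?_ _
      have hN' : (0 : ℝ) < N := by exact_mod_cast hN
      have hnN : (N : ℝ) ≤ n := by exact_mod_cast hn
      have h1 : 1 ≤ (n + β * t) / N := by
        rw [le_div_iff₀ hN']
        nlinarith [mul_nonneg hβ.le ht.1]
      linarith [pow_nonneg hρ (k + 1)]

theorem bdTransition_eq_bdProb {β t : ℝ} (hβ : 0 < β) (ht : t ∈ Set.Icc (0 : ℝ) 1) (n m : ℕ) :
    bdTransition β t n m = ENNReal.ofReal (bdProb β t n m) := by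
  refine le_antisymm (iSup_le fun k => bdApprox_le_bdProb hβ m k t ht n) ?_
  -- The contraction factor depends on `N`, so `k` tends to infinity first, at fixed `N`, and only
  -- then does `N`.
  have hk : ∀ N : ℕ, 0 < N → ENNReal.ofReal (bdProb β t n m) ≤
      bdTransition β t n m + ENNReal.ofReal ((n + β * t) / N + 0) := by
    intro N hN
    have hρ : 1 - Real.exp (-(2 * N + β)) < 1 := by linarith [Real.exp_pos (-(2 * N + β))]
    have hρ0 : 0 ≤ 1 - Real.exp (-(2 * N + β)) := by
      rw [sub_nonneg, Real.exp_le_one_iff]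
      have : (0 : ℝ) ≤ 2 * N + β := by positivity
      linarith
    refine ge_of_tendsto' (((ENNReal.tendsto_ofReal ((tendsto_pow_atTop_nhds_zero_of_lt_one hρ0
      hρ).const_add ((n + β * t) / N))).const_add (bdTransition β t n m))) fun k => ?_
    refine (bdProb_le_bdApprox_add hβ m hN k t ht n).trans ?_
    gcongr
    exact le_iSup (fun k => bdApprox β k t n m) k
  have hlim : Filter.Tendsto (fun N : ℕ => bdTransition β t n m +
      ENNReal.ofReal ((n + β * t) / N + 0)) Filter.atTop (nhds (bdTransition β t n m)) := by
    simpa using (ENNReal.tendsto_ofReal ((tendsto_const_div_atTop_nhds_zero_nat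
      (n + β * t)).add_const 0)).const_add (bdTransition β t n m)
  exact ge_of_tendsto hlim ((Filter.eventually_gt_atTop 0).mono hk)

theorem bdTransition_one {β : ℝ} (hβ : 0 < β) (n m : ℕ) :
    bdTransition β 1 n m = ENNReal.ofReal (negBinCoeff (n + β) 1 m) := by
  rw [bdTransition_eq_bdProb hβ ⟨zero_le_one, le_rfl⟩, bdProb, coeff_bdSeries_one]

/-! ### Identification of the composed kernel -/

lemma negBinCoeff_one (β : ℝ) (n m : ℕ) :
    negBinCoeff (n + β) 1 m = (2 : ℝ) ^ (-((m : ℝ) + n + β)) *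
      ((∏ i ∈ Finset.range m, ((n : ℝ) + β + i)) / m !) := by
  rw [negBinCoeff, one_pow, mul_one, one_add_one_eq_two,
    show -((n : ℝ) + β) - m = -((m : ℝ) + n + β) by ring]

lemma bdKernel_singleton (β t : ℝ) (n m : ℕ) : bdKernel β t n {m} = bdTransition β t n m :=
  Measure.sum_smul_dirac_singleton

instance : IsMarkovKernel poissonKernel := ⟨fun _ => inferInstance⟩

lemma gammaKernel_apply (β : ℝ) (n : ℕ) :
    gammaKernel β n = (gammaMeasure (n + β) 1).map Real.toNNReal := rfl

lemma isMarkovKernel_gammaKernel {β : ℝ} (hβ : 0 < β) : IsMarkovKernel (gammaKernel β) := by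
  refine ⟨fun n => ?_⟩
  have := isProbabilityMeasure_gammaMeasure (a := (n : ℝ) + β) (by positivity) one_pos
  exact Measure.isProbabilityMeasure_map (by fun_prop)

theorem poissonKernel_comp_gammaKernel {β : ℝ} (hβ : 0 < β) :
    poissonKernel ∘ₖ gammaKernel β = bdKernel β 1 := by
  ext1 n
  refine Measure.ext_of_singleton fun m => ?_
  rw [bdKernel_singleton, bdTransition_one hβ,
    ← lintegral_poissonMeasure_gammaMeasure (by positivity) zero_le_one,
    Kernel.comp_apply' _ _ _ (measurableSet_singleton m), gammaKernel_apply,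
    lintegral_map (poissonKernel.measurable_coe (measurableSet_singleton m)) (by fun_prop)]
  simp only [one_mul]
  rfl

lemma isMarkovKernel_bdKernel_one {β : ℝ} (hβ : 0 < β) : IsMarkovKernel (bdKernel β 1) := by
  have := isMarkovKernel_gammaKernel hβ
  rw [← poissonKernel_comp_gammaKernel hβ]
  infer_instance

lemma LamStar_Lam {β : ℝ} (hβ : 0 < β) {g : ℕ → ℝ} {n : ℕ} (hg : Integrable g (bdKernel β 1 n)) :
    LamStar β (Lam g) n = bdOp β 1 g n := by
  rw [← poissonKernel_comp_gammaKernel hβ] at hg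
  rw [bdOp, ← poissonKernel_comp_gammaKernel hβ, Kernel.integral_comp hg]
  rfl

/-! ### The action on `ℓ²(m_β)` -/

lemma mMeasure_singleton (β : ℝ) (n : ℕ) : mMeasure β {n} = ENNReal.ofReal (mWeight β n) :=
  Measure.sum_smul_dirac_singleton

/-- The birth-death chain is reversible with respect to `mMeasure β`. -/
lemma mWeight_mul_negBinCoeff (β : ℝ) (n m : ℕ) :
    mWeight β n * negBinCoeff (n + β) 1 m = mWeight β m * negBinCoeff (m + β) 1 n := by
  -- The rising factorials concatenate into one that depends only on `n + m`, hence is symmetric.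
  have h : ∀ n m : ℕ, (∏ i ∈ Finset.range n, (β + i)) * ∏ i ∈ Finset.range m, ((n : ℝ) + β + i) =
      ∏ i ∈ Finset.range (n + m), (β + i) := fun n m => by
    rw [Finset.prod_range_add]
    congr 1
    exact Finset.prod_congr rfl fun i _ => by push_cast; ring
  have h1 := h n m
  have h2 := h m n
  rw [add_comm m n] at h2
  rw [negBinCoeff_one, negBinCoeff_one, mWeight, mWeight, add_comm (m : ℝ) n]
  linear_combination ((2 : ℝ) ^ (-((n : ℝ) + m + β)) / (n ! * m !)) * (h1 - h2)

/-- By reversibility the mass at `m` is `mWeight β m / mWeight β n` times a probability. The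
domination makes every `ℓ²` function integrable for the kernel. -/
lemma bdKernel_one_le_smul_mMeasure {β : ℝ} (hβ : 0 < β) (n : ℕ) :
    bdKernel β 1 n ≤ ENNReal.ofReal (mWeight β n)⁻¹ • mMeasure β := by
  have hn := mWeight_pos hβ n
  refine Measure.le_iff.2 fun s _ => ?_
  rw [← Measure.tsum_indicator_apply_singleton _ s (Set.to_countable s).measurableSet,
    ← Measure.tsum_indicator_apply_singleton _ s (Set.to_countable s).measurableSet]
  refine ENNReal.tsum_le_tsum fun m => Set.indicator_le_indicator ?_
  rw [bdKernel_singleton, bdTransition_one hβ, Measure.smul_apply, mMeasure_singleton,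
    smul_eq_mul, ← ENNReal.ofReal_mul (by positivity)]
  refine ENNReal.ofReal_le_ofReal ?_
  rw [inv_mul_eq_div, le_div_iff₀' hn, mWeight_mul_negBinCoeff]
  exact mul_le_of_le_one_right (mWeight_pos hβ m).le
    (negBinCoeff_le_one (by positivity) zero_le_one n)

lemma integrable_bdKernel_one {β : ℝ} (hβ : 0 < β) {g : ℕ → ℝ} (hg : MemLp g 2 (mMeasure β))
    (n : ℕ) : Integrable g (bdKernel β 1 n) := by
  have := isMarkovKernel_bdKernel_one hβ
  exact ((hg.smul_measure ENNReal.ofReal_ne_top).mono_measure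
    (bdKernel_one_le_smul_mMeasure hβ n)).integrable (by norm_num)

/-- Bayes' rule: under the improper prior `muMeasure β`, the posterior of the Poisson parameter
given the observation `n` is `Gam (n + β)`, with normalizing constant `mWeight β n`. -/
lemma withDensity_poissonKernel_muMeasure {β : ℝ} (hβ : 0 < β) (n : ℕ) :
    (muMeasure β).withDensity (fun x => poissonKernel x {n}) =
      ENNReal.ofReal (mWeight β n) • gammaKernel β n := by
  have hn : 0 < (n : ℝ) + β := by positivity
  have hG : 0 < Real.Gamma β := Real.Gamma_pos_of_pos hβ
  have hT : Measurable Real.toNNReal := by fun_prop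
  have hP : Measurable fun x : ℝ≥0 => poissonKernel x {n} :=
    poissonKernel.measurable_coe (measurableSet_singleton n)
  have hpdf : Measurable (gammaPDF (n + β) 1) := (measurable_gammaPDFReal _ 1).ennreal_ofReal
  have hmap : ∀ ν : Measure ℝ, (ν.map Real.toNNReal).withDensity (fun x => poissonKernel x {n}) =
      (ν.withDensity ((fun x => poissonKernel x {n}) ∘ Real.toNNReal)).map Real.toNNReal := by
    intro ν
    ext s hs
    rw [withDensity_apply _ hs, Measure.map_apply hT hs, withDensity_apply _ (hT hs),
      setLIntegral_map hs hP hT]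
    rfl
  rw [muMeasure, hmap, gammaKernel_apply, ← Measure.map_smul, gammaMeasure,
    ← withDensity_smul _ hpdf, ← withDensity_mul _ (by fun_prop) (hP.comp hT),
    ← withDensity_indicator measurableSet_Ioi]
  congr 1
  refine withDensity_congr_ae ?_
  -- The two densities may differ at `0`, where the gamma density need not vanish but the indicator
  -- does.
  filter_upwards [Measure.ae_ne volume (0 : ℝ)] with x hx
  rcases hx.lt_or_gt with hx | hx
  · rw [Set.indicator_of_notMem (by simpa using hx.le), Pi.smul_apply, gammaPDF_of_neg hx,
      smul_zero]
  · rw [Set.indicator_of_mem (Set.mem_Ioi.2 hx), Pi.mul_apply, Pi.smul_apply,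
      gammaPDF_of_nonneg hx.le]
    change _ * poissonMeasure _ _ = _
    rw [poissonMeasure_singleton, ← ENNReal.ofReal_mul (by positivity), smul_eq_mul,
      ← ENNReal.ofReal_mul (mWeight_pos hβ n).le, Real.coe_toNNReal x hx.le,
      show (n : ℝ) + β - 1 = n + (β - 1) by ring, Real.rpow_add hx, Real.rpow_natCast,
      Real.one_rpow, one_mul, Gamma_add_nat hβ, mWeight]
    have hprod : 0 < ∏ i ∈ Finset.range n, (β + i) := Finset.prod_pos fun i _ => by positivity
    congr 1
    field_simp

lemma integral_mul_poissonKernel_muMeasure {β : ℝ} (hβ : 0 < β) (f : ℝ≥0 → ℝ) (n : ℕ) :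
    ∫ x, (poissonKernel x).real {n} * f x ∂(muMeasure β) = mWeight β n * LamStar β f n := by
  have h := integral_withDensity_eq_integral_toReal_smul (μ := muMeasure β)
    (poissonKernel.measurable_coe (measurableSet_singleton n))
    (Filter.Eventually.of_forall fun x => measure_lt_top (poissonKernel x) {n}) f
  rw [withDensity_poissonKernel_muMeasure hβ, integral_smul_measure,
    ENNReal.toReal_ofReal (mWeight_pos hβ n).le] at h
  exact h.symm

lemma LamL2_coeFn {β : ℝ} (hβ : 0 < β) (g : Lp ℝ 2 (mMeasure β)) :
    LamL2 β hβ g =ᵐ[muMeasure β] Lam g :=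
  MemLp.coeFn_toLp (memLp_Lam hβ (Lp.memLp g))

lemma Lam_indicator_singleton (n : ℕ) (x : ℝ≥0) :
    Lam (Set.indicator {n} fun _ => 1) x = (poissonKernel x).real {n} := by
  rw [Lam, integral_indicator_const _ (measurableSet_singleton n), smul_eq_mul, mul_one]

/-- Pairing with the indicator of `{n}` reads off the value at `n` up to the weight, and `Λ` maps
that indicator to the Poisson mass at `n`, where the Bayes identity applies. -/
lemma adjoint_LamL2_apply {β : ℝ} (hβ : 0 < β) (f : Lp ℝ 2 (muMeasure β)) (n : ℕ) :
    ContinuousLinearMap.adjoint (LamL2 β hβ) f n = LamStar β f n := by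
  have hfin : mMeasure β {n} ≠ ∞ := by
    rw [mMeasure_singleton]
    exact ENNReal.ofReal_ne_top
  set e := indicatorConstLp 2 (measurableSet_singleton n) hfin (1 : ℝ)
  have he : (e : ℕ → ℝ) = Set.indicator {n} fun _ => 1 :=
    eq_of_ae_mMeasure hβ indicatorConstLp_coeFn
  have h := ContinuousLinearMap.adjoint_inner_right (LamL2 β hβ) e f
  rw [L2.inner_indicatorConstLp_one, integral_singleton, measureReal_def, mMeasure_singleton,
    ENNReal.toReal_ofReal (mWeight_pos hβ n).le, smul_eq_mul, L2.inner_def] at h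
  refine mul_left_cancel₀ (mWeight_pos hβ n).ne' (h.trans ?_)
  rw [← integral_mul_poissonKernel_muMeasure hβ]
  refine integral_congr_ae ?_
  filter_upwards [LamL2_coeFn hβ e] with x hx
  rw [hx, he, Lam_indicator_singleton]
  exact mul_comm _ _

/-- Needed because `LamL2` determines its image only up to null sets; the gamma laws have densities
with respect to `muMeasure β`. -/
lemma LamStar_congr_ae {β : ℝ} (hβ : 0 < β) {f g : ℝ≥0 → ℝ} (h : f =ᵐ[muMeasure β] g) (n : ℕ) :
    LamStar β f n = LamStar β g n := by
  refine mul_left_cancel₀ (mWeight_pos hβ n).ne' ?_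
  rw [← integral_mul_poissonKernel_muMeasure hβ, ← integral_mul_poissonKernel_muMeasure hβ]
  refine integral_congr_ae ?_
  filter_upwards [h] with x hx
  rw [hx]

end BesselGateway

end

theorem proposition14 (β : ℝ) (hβ : 0 < β) :
    -- `Λ*Λ = ℚ_1` as Markov kernels on `ℕ`
    BesselGateway.poissonKernel ∘ₖ BesselGateway.gammaKernel β = BesselGateway.bdKernel β 1 ∧
    -- `Λ*Λ = ℚ_1` as operators on bounded functions, in particular on `c₀(ℕ)`
    (∀ g : ℕ → ℝ, (∃ C : ℝ, ∀ k, |g k| ≤ C) → ∀ n : ℕ,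
      BesselGateway.LamStar β (BesselGateway.Lam g) n = BesselGateway.bdOp β 1 g n) ∧
    -- `Λ*Λ = ℚ_1` as operators on `ℓ²(m_β)`, with `Λ*` the Hilbert space adjoint of `Λ`
    (∀ (g : Lp ℝ 2 (BesselGateway.mMeasure β)) (n : ℕ),
      Integrable g (BesselGateway.bdKernel β 1 n) ∧
      (ContinuousLinearMap.adjoint (BesselGateway.LamL2 β hβ) (BesselGateway.LamL2 β hβ g)) n =
        BesselGateway.bdOp β 1 g n) ∧
    -- the transition probabilities at time `1`
    (∀ m n : ℕ, BesselGateway.bdKernel β 1 n {m} =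
      ENNReal.ofReal ((2 : ℝ) ^ (-((m : ℝ) + n + β)) *
        ((∏ i ∈ Finset.range m, ((n : ℝ) + β + i)) / m !))) := by
  refine ⟨BesselGateway.poissonKernel_comp_gammaKernel hβ, fun g ⟨C, hC⟩ n => ?_, fun g n => ?_,
    fun m n => ?_⟩
  · have := BesselGateway.isMarkovKernel_bdKernel_one hβ
    exact BesselGateway.LamStar_Lam hβ (Integrable.of_bound
      (measurable_of_countable g).aestronglyMeasurable C (Filter.Eventually.of_forall hC))
  · have hg := BesselGateway.integrable_bdKernel_one hβ (Lp.memLp g) n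
    refine ⟨hg, ?_⟩
    rw [BesselGateway.adjoint_LamL2_apply hβ,
      BesselGateway.LamStar_congr_ae hβ (BesselGateway.LamL2_coeFn hβ g),
      BesselGateway.LamStar_Lam hβ hg]
  · rw [BesselGateway.bdKernel_singleton, BesselGateway.bdTransition_one hβ,
      BesselGateway.negBinCoeff_one]
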